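/- Let $F=\mathbb{F}_q$ be a finite field and let $a\in F$ with $a\neq 0,1$. For $A\in F^{n\times n}$ put $C(A,a)=\{B\in F^{n\times n} : AB=aBA\}$, regarded as a linear code of length $n^2$ over $F$; the minimum distance of a nonzero code is the least Hamming weight (number of nonzero entries) of a nonzero codeword. Then there is an integer $n_0$ such that for every $n\ge n_0$ there exists a matrix $A\in F^{n\times n}$ for which the code $C(A,a)$ is nonzero and has minimum distance at least $n/\log n$, where $\log$ is the natural logarithm. -/

import Mathlib

/-- The centralizer code of `A` twisted by `a`: all matrices `B` with `A B = a B A`. -/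
def twistedCentralizerCode {F : Type*} [Field F] {n : ℕ}
    (A : Matrix (Fin n) (Fin n) F) (a : F) : Submodule F (Matrix (Fin n) (Fin n) F) where
  carrier := {B | A * B = a • (B * A)}
  zero_mem' := by simp
  add_mem' := by
    intro B B' hB hB'
    simp only [Set.mem_ofPred_eq] at hB hB' ⊢
    rw [mul_add, add_mul, smul_add, hB, hB']
  smul_mem' := by
    intro c B hB
    simp only [Set.mem_ofPred_eq] at hB ⊢
    rw [Matrix.mul_smul, Matrix.smul_mul, hB, smul_comm]

/-- The Hamming weight of a matrix, i.e. the number of its nonzero entries: the matrix is read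
column by column as a vector with `n ^ 2` coordinates. -/
def matrixWeight {F : Type*} [Field F] [DecidableEq F] {n : ℕ}
    (B : Matrix (Fin n) (Fin n) F) : ℕ :=
  hammingNorm B.vec

/-- The minimum distance of a nonzero linear code of matrices: the least Hamming weight of a
nonzero codeword. (For the zero code, which has no minimum distance, the value is the junk
value `0`.) -/
noncomputable def minDistance {F : Type*} [Field F] [DecidableEq F] {n : ℕ}
    (C : Submodule F (Matrix (Fin n) (Fin n) F)) : ℕ :=
  sInf {w : ℕ | ∃ B ∈ C, B ≠ 0 ∧ matrixWeight B = w}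

/-!
Let `e = u vᵀ` with `vᵀ u = 1`, a rank-one idempotent. For an idempotent `A`, the equation
`A B = a B A` with `a ≠ 0, 1` forces `A B = B A = 0`, so `C(1 - e, a) = e F^{n × n} e = F e`. The
minimum distance is then the weight of `e`, which is `n ^ 2` as soon as `u` and `v` have no zero
coordinate. Such vectors with `vᵀ u = 1` exist because `F` has the two distinct nonzero elements
`1` and `a`.
-/

open Matrix

theorem mul_eq_smul_mul_iff_of_isIdempotentElem {K R : Type*} [DivisionRing K] [NonUnitalRing R]
    [Module K R] [IsScalarTower K R R] [SMulCommClass K R R] {a : K} (ha0 : a ≠ 0) (ha1 : a ≠ 1)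
    {p : R} (hp : IsIdempotentElem p) (x : R) :
    p * x = a • (x * p) ↔ p * x = 0 ∧ x * p = 0 := by
  refine ⟨fun h => ?_, fun ⟨hpx, hxp⟩ => by rw [hpx, hxp, smul_zero]⟩
  have hpxp : p * x * p = p * x := by
    rw [h, smul_mul_assoc, hp.mul_mul_self]
  have hpx_smul : p * x = a • (p * x) := by
    calc p * x = p * (p * x) := (hp.mul_self_mul x).symm
      _ = p * (a • (x * p)) := by rw [h]
      _ = a • (p * x * p) := by rw [mul_smul_comm, mul_assoc]
      _ = a • (p * x) := by rw [hpxp]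
  have hpx : p * x = 0 := by
    have hsub : (1 - a) • (p * x) = 0 := by rw [sub_smul, one_smul, sub_eq_zero, ← hpx_smul]
    exact (smul_eq_zero.1 hsub).resolve_left (sub_ne_zero.2 ha1.symm)
  exact ⟨hpx, (smul_eq_zero.1 (h.symm.trans hpx)).resolve_left ha0⟩

theorem isIdempotentElem_vecMulVec {ι R : Type*} [Fintype ι] [CommSemiring R] {u v : ι → R}
    (h : v ⬝ᵥ u = 1) : IsIdempotentElem (vecMulVec u v) := by
  rw [IsIdempotentElem, vecMulVec_mul_vecMulVec, h, one_smul]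

theorem exists_forall_ne_zero_dotProduct_one_eq_one {ι F : Type*} [Fintype ι] [Nonempty ι]
    [Field F] {a : F} (ha0 : a ≠ 0) (ha1 : a ≠ 1) :
    ∃ v : ι → F, (∀ i, v i ≠ 0) ∧ v ⬝ᵥ 1 = 1 := by
  classical
  obtain ⟨i₀⟩ := ‹Nonempty ι›
  suffices ∃ w : ι → F, (∀ i, w i ≠ 0) ∧ w ⬝ᵥ 1 ≠ 0 by
    obtain ⟨w, hw, hsum⟩ := this
    refine ⟨(w ⬝ᵥ 1)⁻¹ • w, fun i => mul_ne_zero (inv_ne_zero hsum) (hw i), ?_⟩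
    rw [smul_dotProduct, smul_eq_mul, inv_mul_cancel₀ hsum]
  by_cases hone : (1 : ι → F) ⬝ᵥ 1 = 0
  · -- Changing one coordinate from `1` to `a` changes the sum from `0` to `a - 1`.
    refine ⟨1 + Pi.single i₀ (a - 1), fun i => ?_, ?_⟩
    · obtain rfl | hi := eq_or_ne i i₀
      · simpa using ha0
      · simp [hi]
    · rw [add_dotProduct, hone, zero_add, single_dotProduct, Pi.one_apply, mul_one]
      exact sub_ne_zero.2 ha1
  · exact ⟨1, fun _ => one_ne_zero, hone⟩

section Code

variable {F : Type*} [Field F] {n : ℕ}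

theorem mem_twistedCentralizerCode_one_sub_iff {a : F} (ha0 : a ≠ 0) (ha1 : a ≠ 1)
    {E : Matrix (Fin n) (Fin n) F} (hE : IsIdempotentElem E) {B : Matrix (Fin n) (Fin n) F} :
    B ∈ twistedCentralizerCode (1 - E) a ↔ E * B = B ∧ B * E = B := by
  change (1 - E) * B = a • (B * (1 - E)) ↔ _
  rw [mul_eq_smul_mul_iff_of_isIdempotentElem ha0 ha1 hE.one_sub, sub_mul, mul_sub, one_mul,
    mul_one, sub_eq_zero, sub_eq_zero, eq_comm, @eq_comm _ B (B * E)]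

theorem twistedCentralizerCode_one_sub_vecMulVec {a : F} (ha0 : a ≠ 0) (ha1 : a ≠ 1)
    {u v : Fin n → F} (h : v ⬝ᵥ u = 1) :
    twistedCentralizerCode (1 - vecMulVec u v) a = Submodule.span F {vecMulVec u v} := by
  have hE := isIdempotentElem_vecMulVec h
  ext B
  rw [mem_twistedCentralizerCode_one_sub_iff ha0 ha1 hE, Submodule.mem_span_singleton]
  constructor
  · rintro ⟨hEB, hBE⟩
    refine ⟨(v ᵥ* B) ⬝ᵥ u, ?_⟩
    calc ((v ᵥ* B) ⬝ᵥ u) • vecMulVec u v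
        = vecMulVec u v * B * vecMulVec u v := by
          rw [vecMulVec_mul, vecMulVec_mul_vecMulVec, vecMulVec_smul]
      _ = B := by rw [hEB, hBE]
  · rintro ⟨c, rfl⟩
    rw [mul_smul_comm, smul_mul_assoc, hE.eq]
    exact ⟨rfl, rfl⟩

variable [DecidableEq F]

theorem matrixWeight_eq_sq_of_forall_ne_zero {B : Matrix (Fin n) (Fin n) F}
    (hB : ∀ i j, B i j ≠ 0) : matrixWeight B = n ^ 2 := by
  have hvec : ∀ k, B.vec k ≠ 0 := fun k => hB k.2 k.1
  rw [matrixWeight, hammingNorm, Finset.filter_true_of_mem fun k _ => hvec k]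
  simp [sq]

theorem matrixWeight_smul {c : F} (hc : c ≠ 0) (B : Matrix (Fin n) (Fin n) F) :
    matrixWeight (c • B) = matrixWeight B := by
  rw [matrixWeight, matrixWeight, vec_smul]
  exact hammingNorm_smul (fun _ => (IsUnit.mk0 c hc).isSMulRegular F) B.vec

theorem minDistance_span_singleton {B : Matrix (Fin n) (Fin n) F} (hB : B ≠ 0) :
    minDistance (Submodule.span F {B}) = matrixWeight B := by
  have hweights : {w : ℕ | ∃ B' ∈ Submodule.span F {B}, B' ≠ 0 ∧ matrixWeight B' = w}
      = {matrixWeight B} := by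
    ext w
    constructor
    · rintro ⟨B', hB', hne, rfl⟩
      obtain ⟨c, rfl⟩ := Submodule.mem_span_singleton.1 hB'
      exact matrixWeight_smul (left_ne_zero_of_smul hne) B
    · rintro rfl
      exact ⟨B, Submodule.mem_span_singleton_self B, hB, rfl⟩
  rw [minDistance, hweights, csInf_singleton]

theorem theorem3p6_general [NeZero n] {a : F} (ha0 : a ≠ 0) (ha1 : a ≠ 1) :
    ∃ A : Matrix (Fin n) (Fin n) F,
      twistedCentralizerCode A a ≠ ⊥ ∧ minDistance (twistedCentralizerCode A a) = n ^ 2 := by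
  obtain ⟨v, hv, hsum⟩ := exists_forall_ne_zero_dotProduct_one_eq_one (ι := Fin n) ha0 ha1
  have hentries : ∀ i j, vecMulVec (1 : Fin n → F) v i j ≠ 0 := fun i j => by
    simpa [vecMulVec_apply] using hv j
  have hne : vecMulVec (1 : Fin n → F) v ≠ 0 := fun h => hentries 0 0 (by simp [h])
  refine ⟨1 - vecMulVec 1 v, ?_⟩
  rw [twistedCentralizerCode_one_sub_vecMulVec ha0 ha1 hsum, minDistance_span_singleton hne]
  exact ⟨mt Submodule.span_singleton_eq_bot.1 hne,
    matrixWeight_eq_sq_of_forall_ne_zero hentries⟩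

end Code

theorem div_log_le_sq {x : ℝ} (hx : 2 ≤ x) : x / Real.log x ≤ x ^ 2 := by
  have hx0 : 0 < x := by linarith
  rw [div_le_iff₀ (Real.log_pos (by linarith))]
  calc x ≤ x ^ 2 * (1 - x⁻¹) := by field_simp; nlinarith
    _ ≤ x ^ 2 * Real.log x := by gcongr; exact Real.one_sub_inv_le_log_of_pos hx0

theorem theorem3p6 {F : Type*} [Field F] [Fintype F] [DecidableEq F]
    (a : F) (ha0 : a ≠ 0) (ha1 : a ≠ 1) :
    ∀ᶠ n : ℕ in Filter.atTop, ∃ A : Matrix (Fin n) (Fin n) F,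
      twistedCentralizerCode A a ≠ ⊥ ∧
        (n : ℝ) / Real.log n ≤ (minDistance (twistedCentralizerCode A a) : ℝ) := by
  filter_upwards [Filter.eventually_ge_atTop 2] with n hn
  have : NeZero n := ⟨by omega⟩
  obtain ⟨A, hA, hd⟩ := theorem3p6_general (n := n) ha0 ha1
  exact ⟨A, hA, by rw [hd]; exact_mod_cast div_log_le_sq (Nat.ofNat_le_cast.2 hn)⟩
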